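/- For $n\ge 1$ consider operators on the Hilbert space $(\mathbb C^2)^{\otimes n}$ of $n$ qubits, with $\|\cdot\|$ the operator norm and $\|A\|_1=\operatorname{tr}\sqrt{A^\dagger A}$ the trace norm. For a subspace $\mathcal V$ let $P_{\mathcal V}$ be the orthogonal projector onto it. For $r\ge 0$ let $\mathcal B_r(\mathcal V)$ be the span of all $S|\psi\rangle$ with $|\psi\rangle\in\mathcal V$ and $S$ a product of Pauli matrices acting non-trivially on at most $r$ qubits, and let $\partial_r\mathcal V=\mathcal B_r(\mathcal V)\cap\mathcal V^\perp$. For a Hamiltonian $H_0$ let $E_{0,\min}(\mathcal V)$ be the minimum of $\langle\psi|H_0|\psi\rangle$ over unit vectors $|\psi\rangle\in\mathcal V$ ($+\infty$ if $\mathcal V=0$). **Theorem (stability of states with extensive energy barriers).** Fix integers $k,w_0,w_1\ge 0$ and reals $\kappa>0$ and $0\le\epsilon<\kappa/2$. There is $\beta_*>0$ with $\beta_*\le\frac{\ln 2}{\kappa-2\epsilon}$ (and $\beta_*<\frac{\ln 2}{\kappa-2\epsilon}$ if $\epsilon>0$) such that for every $\beta>\beta_*$ there is $g_*(\beta)>0$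 such that for every $g<g_*(\beta)$ there are $c>0$ and $n_0$ for which the following holds for all $n\ge n_0$. Let * $H_0=\sum_j\Pi_j$ be a sum of mutually commuting orthogonal projectors on $n$ qubits, each acting on at most $k$ qubits, with each qubit acted on by at most $w_0$ of them; * $V$ be a self-adjoint operator with $\|V\|\le gn$ that is a sum of terms acting on at most $w_1$ qubits each; * $r\ge 0$ be any integer (it may depend on $n$), and let $\mathcal V$ be a subspace with boundary $\partial\mathcal V=\partial_r\mathcal V$ such that $E_{0,\min}(\mathcal V)\le\epsilon n$, $E_{0,\min}(\partial\mathcal V)\ge E_{0,\min}(\mathcal V)+\kappa n$, and $H_0$ is block-diagonal with respect to $\partial\mathcal V\oplus\partial\mathcal V^\perp$, i.e. $[H_0,P_{\partial\mathcal V}]=0$. Then the Gibbs state $\rho_G=e^{-\beta(H_0+V)}/\operatorname{tr}e^{-\beta(H_0+V)}$ satisfies $$\Delta=\frac{\|P_{\partial\mathcal V}\,\rho_G\|_1}{\operatorname{tr}(P_{\mathcal V}\,\rho_G)}\le e^{-cn}.$$ -/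

import Mathlib

open scoped BigOperators InnerProductSpace

noncomputable section

namespace QBottleneck

/-- The Hilbert space of `n` qubits, with the computational basis indexed by bit strings. -/
abbrev Qubits (n : ℕ) : Type := EuclideanSpace ℂ (Fin n → Fin 2)

/-- Operators on `n` qubits; the norm on this type is the operator norm. -/
abbrev Op (n : ℕ) : Type := Qubits n →L[ℂ] Qubits n

/-- The operator with given matrix elements in the computational basis. -/
def opOfMatrix {n : ℕ} (A : Matrix (Fin n → Fin 2) (Fin n → Fin 2) ℂ) : Op n :=
  Matrix.toEuclideanCLM (n := Fin n → Fin 2) (𝕜 := ℂ) A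

/-- The single-qubit Pauli matrices `1, X, Y, Z`. -/
def pauli : Fin 4 → Matrix (Fin 2) (Fin 2) ℂ :=
  ![1, !![0, 1; 1, 0], !![0, -Complex.I; Complex.I, 0], !![1, 0; 0, -1]]

/-- The tensor product of the Pauli matrices prescribed by `s`, one for each qubit. -/
def pauliString {n : ℕ} (s : Fin n → Fin 4) : Op n :=
  opOfMatrix (Matrix.of fun x y => ∏ i, pauli (s i) (x i) (y i))

/-- The set of qubits on which a Pauli string acts non-trivially. -/
def pauliSupport {n : ℕ} (s : Fin n → Fin 4) : Finset (Fin n) :=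
  Finset.univ.filter fun i => s i ≠ 0

/-- The `r`-neighbourhood of `𝒱`: the span of all `S ψ` with `ψ ∈ 𝒱` and `S` a Pauli string
supported on at most `r` qubits. -/
def nbhd {n : ℕ} (r : ℕ) (𝒱 : Submodule ℂ (Qubits n)) : Submodule ℂ (Qubits n) :=
  Submodule.span ℂ
    {φ | ∃ s : Fin n → Fin 4, (pauliSupport s).card ≤ r ∧ ∃ ψ ∈ 𝒱, φ = pauliString s ψ}

/-- The `r`-boundary of `𝒱`: the orthogonal complement of `𝒱` within its `r`-neighbourhood. -/
def boundary {n : ℕ} (r : ℕ) (𝒱 : Submodule ℂ (Qubits n)) : Submodule ℂ (Qubits n) :=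
  nbhd r 𝒱 ⊓ 𝒱ᗮ

/-- The orthogonal projector onto a subspace. -/
def proj {n : ℕ} (𝒱 : Submodule ℂ (Qubits n)) : Op n := 𝒱.starProjection

/-- `A` acts only on the qubits in `T`, that is `A = B ⊗ 1` with `B` an operator on the qubits
in `T` and `1` the identity on the other qubits. -/
def ActsOn {n : ℕ} (T : Finset (Fin n)) (A : Op n) : Prop :=
  ∃ B : Matrix (T → Fin 2) (T → Fin 2) ℂ,
    A = opOfMatrix (Matrix.of fun x y =>
      if ∀ i, i ∉ T → x i = y i then B (fun i => x i) (fun i => y i) else 0)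

/-- A family of mutually commuting orthogonal projectors on `n` qubits, each acting on at most
`k` qubits, such that each qubit is acted on by at most `w₀` of them. -/
structure CommutingProjectors (n k w₀ : ℕ) where
  /-- the number of terms -/
  m : ℕ
  /-- the projectors -/
  term : Fin m → Op n
  /-- the qubits on which they act -/
  supp : Fin m → Finset (Fin n)
  isProjector : ∀ j, IsStarProjection (term j)
  commute : ∀ i j, Commute (term i) (term j)
  actsOn : ∀ j, ActsOn (supp j) (term j)
  card_supp_le : ∀ j, (supp j).card ≤ k
  degree_le : ∀ q : Fin n, (Finset.univ.filter fun j => q ∈ supp j).card ≤ w₀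

/-- The Hamiltonian that is the sum of the projectors. -/
def CommutingProjectors.ham {n k w₀ : ℕ} (P : CommutingProjectors n k w₀) : Op n :=
  ∑ j, P.term j

/-- `V` is a self-adjoint operator that is a sum of terms acting on at most `w₁` qubits each. -/
def IsLocalPerturbation {n : ℕ} (w₁ : ℕ) (V : Op n) : Prop :=
  IsSelfAdjoint V ∧ ∃ (m : ℕ) (t : Fin m → Op n),
    (∀ l, ∃ T : Finset (Fin n), T.card ≤ w₁ ∧ ActsOn T (t l)) ∧ V = ∑ l, t l

/-- The minimal energy `⟨ψ, H ψ⟩` of the unit vectors of `𝒱` (which is `+∞` if `𝒱 = 0`). -/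
def minEnergy {n : ℕ} (H : Op n) (𝒱 : Submodule ℂ (Qubits n)) : EReal :=
  ⨅ ψ ∈ 𝒱, ⨅ _ : ‖ψ‖ = 1, ((RCLike.re ⟪ψ, H ψ⟫_ℂ : ℝ) : EReal)

/-- The trace of an operator. -/
def tr {n : ℕ} (A : Op n) : ℂ := LinearMap.trace ℂ (Qubits n) A.toLinearMap

/-- The trace norm, the trace of `|A| = √(A† A)`. -/
def traceNorm {n : ℕ} (A : Op n) : ℝ := (tr (CFC.abs A)).re

/-- The Gibbs state `e^{-βH} / tr e^{-βH}`. -/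
def gibbs {n : ℕ} (β : ℝ) (H : Op n) : Op n :=
  (tr (NormedSpace.exp ((-β : ℂ) • H)))⁻¹ • NormedSpace.exp ((-β : ℂ) • H)

/-- The bottleneck ratio of the state `ρ` for the subspace `𝒱` and its `r`-boundary. -/
def bottleneckRatio {n : ℕ} (ρ : Op n) (r : ℕ) (𝒱 : Submodule ℂ (Qubits n)) : ℝ :=
  traceNorm (proj (boundary r 𝒱) * ρ) / (tr (proj 𝒱 * ρ)).re

end QBottleneck

end

/-!
The constant is `β_* = log 2 / κ`, and the proof compares `e^{-β(H₀ + V)}` with `e^{-βH₀}` through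
`F(t) = e^{tH₀} e^{-t(H₀ + V)}`.

Since `F' = -(e^{tH₀} V e^{-tH₀}) F`, Grönwall's inequality bounds `‖F(β)‖` as soon as the
imaginary-time evolution `e^{tH₀} V e^{-tH₀}` is under control (`norm_exp_mul_exp_neg_add_le`). The
terms of `V` may be arbitrarily large, only the norm of their sum is bounded, so the evolution must
be estimated in terms of `‖V‖` alone. A term of `V` meets at most `D = w₁ w₀` of the commuting
projectors, so that its evolution, as a function of complex time `z`, is an exponential sum
`∑ e^{kz} Yₖ` with integer frequencies `|k| ≤ D`
(`CommutingProjectors.evolve_mem_expSums_of_actsOn`). This property is linear in the operator, hence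
holds for `V`. At imaginary `z` the evolution is unitary and preserves the norm, and an exponential
sum of degree `D` is determined by its values at `2D + 1` equidistant imaginary points. Discrete
Fourier interpolation thus gives `‖e^{tH₀} V e^{-tH₀}‖ ≤ (2D + 1) e^{tD} ‖V‖`
(`norm_le_of_mem_expSums`), and `‖F(β)‖ ≤ e^{O(g n)}`.

Let `P` be the projector onto the boundary and `E` the minimal energy of `𝒱`. As `P` commutes with
`H₀` and the energy on its range is at least `E + κn`, one has `‖P e^{-βH₀}‖ ≤ e^{-β(E + κn)}`, and
`P e^{-β(H₀ + V)} = P e^{-βH₀} F(β)` has trace norm at most `2ⁿ e^{-β(E + κn) + O(g n)}`. On the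
other hand Jensen's inequality for a nearly optimal vector of `𝒱` shows that the overlap of
`e^{-β(H₀ + V)}` with `𝒱` is at least about `e^{-β(E + g n)}` (`exp_re_inner_le`). The ratio
is at most `exp (n (log 2 - βκ + O(g)))` (`bottleneckRatio_gibbs_le`), which decays
exponentially when `β > log 2 / κ` and `g` is small.
-/

namespace QBottleneck

/-! ### Exponential sums with bounded integer frequencies -/

section BanachAlgebra

variable {𝔸 : Type*} [NormedRing 𝔸] [NormedAlgebra ℂ 𝔸]

variable (𝔸) in
/-- The exponential sums `z ↦ ∑ₖ e^{kz} Yₖ` with integer frequencies `|k| ≤ D`. -/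
noncomputable def expSums (D : ℕ) : Submodule ℂ (ℂ → 𝔸) :=
  Submodule.span ℂ {f | ∃ k : ℤ, |k| ≤ D ∧ ∃ Y : 𝔸, f = fun z => Complex.exp (k * z) • Y}

theorem mem_expSums {D : ℕ} {k : ℤ} (hk : |k| ≤ D) (Y : 𝔸) :
    (fun z : ℂ => Complex.exp (k * z) • Y) ∈ expSums 𝔸 D :=
  Submodule.subset_span ⟨k, hk, Y, rfl⟩

theorem expSums_mono {D D' : ℕ} (h : D ≤ D') : expSums 𝔸 D ≤ expSums 𝔸 D' := by
  refine Submodule.span_mono ?_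
  rintro f ⟨k, hk, Y, rfl⟩
  exact ⟨k, hk.trans (by exact_mod_cast h), Y, rfl⟩

/-- Orthogonality of the characters of `ℤ/N`, at the points `2πij/N`. -/
theorem sum_exp_two_pi_mul_div {N : ℕ} (hN : 0 < N) {k : ℤ} (hk : |k| < N) :
    ∑ j ∈ Finset.range N, Complex.exp (k * (2 * Real.pi * (j / N : ℝ) * Complex.I)) =
      if k = 0 then (N : ℂ) else 0 := by
  split_ifs with h0
  · simp [h0]
  have hN' : (N : ℂ) ≠ 0 := by exact_mod_cast hN.ne'
  set ζ : ℂ := Complex.exp (k * (2 * Real.pi * Complex.I / N)) with hζ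
  have e : ∀ j : ℕ, Complex.exp (k * (2 * Real.pi * (j / N : ℝ) * Complex.I)) = ζ ^ j := by
    intro j
    rw [hζ, ← Complex.exp_nat_mul]
    congr 1; push_cast; ring
  have hζN : ζ ^ N = 1 := by
    rw [hζ, ← Complex.exp_nat_mul]
    rw [Complex.exp_eq_one_iff]
    exact ⟨k, by field_simp⟩
  have hζ1 : ζ ≠ 1 := by
    rw [hζ, Ne, Complex.exp_eq_one_iff]
    rintro ⟨m, hm⟩
    have hpi : (2 * Real.pi * Complex.I : ℂ) ≠ 0 := Complex.two_pi_I_ne_zero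
    have h1 : (k : ℂ) = m * N := by
      field_simp at hm
      have : (2 * Real.pi * Complex.I : ℂ) * k = (2 * Real.pi * Complex.I : ℂ) * (m * N) := by
        linear_combination (2 * Real.pi * Complex.I : ℂ) * hm
      exact mul_left_cancel₀ hpi this
    have h2 : k = m * N := by exact_mod_cast h1
    exact h0 (Int.eq_zero_of_abs_lt_dvd ⟨m, by rw [h2, mul_comm]⟩ hk)
  simp only [e]
  rw [geom_sum_eq hζ1, hζN, sub_self, zero_div]

/-- An exponential sum of degree `D` that is bounded by `M` on the imaginary axis is bounded by
`(2D + 1) e^{tD} M` at real `t ≥ 0`, because `f t` is a combination of the values of `f` at the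
`2D + 1` points `2πij/(2D + 1)`, with coefficients of norm at most `e^{tD}` that depend on `t`
only. -/
theorem norm_le_of_mem_expSums {D : ℕ} {f : ℂ → 𝔸} (hf : f ∈ expSums 𝔸 D) {M : ℝ}
    (hM : ∀ θ : ℝ, ‖f (θ * Complex.I)‖ ≤ M) {t : ℝ} (ht : 0 ≤ t) :
    ‖f t‖ ≤ (2 * D + 1) * Real.exp (t * D) * M := by
  set N : ℕ := 2 * D + 1 with hN
  have hN0 : (N : ℂ) ≠ 0 := Nat.cast_ne_zero.2 (by omega)
  let θ : ℕ → ℝ := fun j => 2 * Real.pi * (j / N : ℝ)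
  -- the discrete Fourier coefficients of `ω ↦ e^{tω}`, `|ω| ≤ D`, extended `N`-periodically
  let c : ℕ → ℂ := fun j => (N : ℂ)⁻¹ * ∑ ω ∈ Finset.Icc (-D : ℤ) D,
    Complex.exp (ω * t) * Complex.exp (-ω * (θ j * Complex.I))
  have hint : f t = ∑ j ∈ Finset.range N, c j • f (θ j * Complex.I) := by
    clear hM
    induction hf using Submodule.span_induction with
    | mem f hf =>
      obtain ⟨k, hk, Y, rfl⟩ := hf
      simp only [smul_smul, ← Finset.sum_smul]
      congr 1
      simp only [c, Finset.mul_sum, Finset.sum_mul]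
      rw [Finset.sum_comm]
      have hkD := abs_le.1 hk
      rw [Finset.sum_eq_single_of_mem k (Finset.mem_Icc.2 hkD)]
      · have : ∀ j ∈ Finset.range N, (N : ℂ)⁻¹ * (Complex.exp (k * t) *
            Complex.exp (-k * (θ j * Complex.I))) * Complex.exp (k * (θ j * Complex.I)) =
            (N : ℂ)⁻¹ * Complex.exp (k * t) := by
          intro j _
          rw [mul_assoc, mul_assoc, ← Complex.exp_add]
          simp
        rw [Finset.sum_congr rfl this]
        simp [hN0]
      · intro ω hω hne
        have hω' := Finset.mem_Icc.1 hω
        have : ∀ j ∈ Finset.range N, (N : ℂ)⁻¹ * (Complex.exp (ω * t) *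
            Complex.exp (-ω * (θ j * Complex.I))) * Complex.exp (k * (θ j * Complex.I)) =
            (N : ℂ)⁻¹ * Complex.exp (ω * t) *
              Complex.exp ((k - ω : ℤ) * (2 * Real.pi * (j / N : ℝ) * Complex.I)) := by
          intro j _
          rw [mul_assoc, mul_assoc, ← Complex.exp_add, mul_assoc]
          congr 3
          simp only [θ]
          push_cast; ring
        rw [Finset.sum_congr rfl this, ← Finset.mul_sum,
          sum_exp_two_pi_mul_div (by omega) (by rw [abs_lt, hN]; push_cast; constructor <;> omega),
          if_neg (by omega), mul_zero]
    | zero => simp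
    | add f g _ _ hf hg => simp [hf, hg, Finset.sum_add_distrib]
    | smul a f _ hf =>
      simp only [Pi.smul_apply, hf, Finset.smul_sum]
      exact Finset.sum_congr rfl fun j _ => smul_comm _ _ _
  have hM0 : 0 ≤ M := (norm_nonneg _).trans (hM 0)
  have hcard : (Finset.Icc (-D : ℤ) D).card = N := by rw [Int.card_Icc]; omega
  have hc : ∀ j, ‖c j‖ ≤ Real.exp (t * D) := by
    intro j
    have h1 : ‖∑ ω ∈ Finset.Icc (-D : ℤ) D,
        Complex.exp (ω * t) * Complex.exp (-ω * (θ j * Complex.I))‖ ≤ N * Real.exp (t * D) := by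
      rw [← hcard, ← nsmul_eq_mul]
      refine norm_sum_le_of_le _ (fun ω hω => ?_) |>.trans_eq (Finset.sum_const _)
      have hω' := Finset.mem_Icc.1 hω
      have hωR : (ω : ℝ) ≤ D := by exact_mod_cast hω'.2
      rw [norm_mul, Complex.norm_exp, Complex.norm_exp]
      simp only [Complex.mul_re, Complex.intCast_re, Complex.intCast_im, Complex.ofReal_re,
        Complex.ofReal_im, Complex.neg_re, Complex.neg_im, Complex.I_re, Complex.I_im,
        Complex.mul_im]
      simp only [mul_zero, zero_mul, sub_zero, neg_zero, Real.exp_zero, mul_one]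
      rw [mul_comm]
      gcongr
    rw [norm_mul, norm_inv, Complex.norm_natCast]
    have hNpos : (0 : ℝ) < N := by rw [hN]; positivity
    rw [inv_mul_le_iff₀ hNpos]
    exact h1
  rw [hint]
  calc ‖∑ j ∈ Finset.range N, c j • f (θ j * Complex.I)‖
      ≤ ∑ j ∈ Finset.range N, Real.exp (t * D) * M := by
        refine norm_sum_le_of_le _ fun j _ => ?_
        rw [norm_smul]
        exact mul_le_mul (hc j) (hM _) (norm_nonneg _) (Real.exp_pos _).le
    _ = (2 * D + 1) * Real.exp (t * D) * M := by
        rw [Finset.sum_const, Finset.card_range, nsmul_eq_mul, hN]; push_cast; ring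

/-! ### Exponentials and imaginary-time evolution in a Banach algebra -/

variable [CompleteSpace 𝔸]

theorem exp_add_of_commute {X Y : 𝔸} (h : Commute X Y) :
    NormedSpace.exp (X + Y) = NormedSpace.exp X * NormedSpace.exp Y :=
  let := NormedAlgebra.restrictScalars ℚ ℂ 𝔸
  NormedSpace.exp_add_of_commute h

theorem exp_mul_exp_neg (X : 𝔸) : NormedSpace.exp X * NormedSpace.exp (-X) = 1 := by
  rw [← exp_add_of_commute (Commute.refl X).neg_right, add_neg_cancel, NormedSpace.exp_zero]

theorem exp_mul_of_mul_eq_smul {X Q : 𝔸} {c : ℂ} (h : X * Q = c • Q) :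
    NormedSpace.exp X * Q = Complex.exp c • Q := by
  have h1 := (NormedSpace.exp_series_hasSum_exp' (𝕂 := ℂ) X).mul_right Q
  have h2 := (NormedSpace.exp_series_hasSum_exp' (𝕂 := ℂ) c).smul_const Q
  rw [← Complex.exp_eq_exp_ℂ] at h2
  have hp : ∀ m : ℕ, X ^ m * Q = c ^ m • Q := by
    intro m
    induction m with
    | zero => simp
    | succ m ih => rw [pow_succ', mul_assoc, ih, mul_smul_comm, h, smul_smul, pow_succ]
  refine h1.unique (h2.congr_fun ?_)
  intro m
  simp [hp, smul_smul]

theorem exp_add_smul_one (X : 𝔸) (c : ℂ) :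
    NormedSpace.exp (X + c • (1 : 𝔸)) = Complex.exp c • NormedSpace.exp X := by
  rw [exp_add_of_commute ((Commute.one_right X).smul_right c)]
  have : NormedSpace.exp (c • (1 : 𝔸)) * 1 = Complex.exp c • 1 :=
    exp_mul_of_mul_eq_smul (by simp)
  rw [mul_one] at this
  rw [this, mul_smul_comm, mul_one]

theorem exp_smul_of_isIdempotentElem {Q : 𝔸} (hQ : IsIdempotentElem Q) (z : ℂ) :
    NormedSpace.exp (z • Q) = (1 - Q) + Complex.exp z • Q := by
  have h1 : NormedSpace.exp (z • Q) * Q = Complex.exp z • Q :=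
    exp_mul_of_mul_eq_smul (by rw [smul_mul_assoc, hQ.eq])
  have h2 : NormedSpace.exp (z • Q) * (1 - Q) = Complex.exp 0 • (1 - Q) :=
    exp_mul_of_mul_eq_smul (by rw [smul_mul_assoc, mul_sub, hQ.eq]; simp)
  rw [Complex.exp_zero, one_smul] at h2
  rw [← h1, ← h2, ← mul_add, sub_add_cancel, mul_one]

/-- On the range of a commuting idempotent `Q` only the part `X Q` of `X` matters. -/
theorem exp_mul_of_commute_idempotent {X Q : 𝔸} (hQ : IsIdempotentElem Q) (h : Commute X Q) :
    NormedSpace.exp X * Q = NormedSpace.exp (X * Q) * Q := by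
  have hc : Commute (X * Q) (X * (1 - Q)) := by
    have e : (X * Q) * (X * (1 - Q)) = 0 := by
      rw [mul_assoc, ← mul_assoc Q, ← h.eq, mul_assoc X Q, mul_sub, hQ.eq]; simp
    have e' : (X * (1 - Q)) * (X * Q) = 0 := by
      rw [h.eq, mul_assoc, ← mul_assoc (1 - Q), sub_mul, hQ.eq]; simp
    exact e.trans e'.symm
  have hz : X * (1 - Q) * Q = (0 : ℂ) • Q := by
    rw [mul_assoc, sub_mul, hQ.eq]; simp
  have hX : X = X * Q + X * (1 - Q) := by rw [← mul_add]; simp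
  conv_lhs => rw [hX]
  rw [exp_add_of_commute hc, mul_assoc, exp_mul_of_mul_eq_smul hz]
  simp

/-- The evolution `e^{zH} X e^{-zH}` of `X` as a function of the complex parameter `z`:
imaginary-time evolution for real `z`, Heisenberg evolution for imaginary `z`. -/
noncomputable def evolve (H X : 𝔸) (z : ℂ) : 𝔸 :=
  NormedSpace.exp (z • H) * X * NormedSpace.exp (-(z • H))

/-- Conjugation by `e^{zQ} = (1 - Q) + e^z Q` shifts frequencies by at most one: the blocks of
`Y` that are diagonal with respect to `Q` are fixed, the two others get a factor `e^{±z}`. -/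
theorem evolve_idempotent_mem_expSums {Q : 𝔸} (hQ : IsIdempotentElem Q) {D : ℕ} {f : ℂ → 𝔸}
    (hf : f ∈ expSums 𝔸 D) : (fun z => evolve Q (f z) z) ∈ expSums 𝔸 (D + 1) := by
  induction hf using Submodule.span_induction with
  | mem f hf =>
    obtain ⟨k, hk, Y, rfl⟩ := hf
    have key : (fun z => evolve Q (Complex.exp (k * z) • Y) z) =
        (fun z : ℂ => Complex.exp (k * z) • ((1 - Q) * Y * (1 - Q) + Q * Y * Q)) +
        (fun z : ℂ => Complex.exp ((k + 1 : ℤ) * z) • (Q * Y * (1 - Q))) +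
        (fun z : ℂ => Complex.exp ((k - 1 : ℤ) * z) • ((1 - Q) * Y * Q)) := by
      funext z
      have e1 : Complex.exp ((k + 1 : ℤ) * z) = Complex.exp (k * z) * Complex.exp z := by
        rw [← Complex.exp_add]; push_cast; ring_nf
      have e2 : Complex.exp ((k - 1 : ℤ) * z) = Complex.exp (k * z) * Complex.exp (-z) := by
        rw [← Complex.exp_add]; push_cast; ring_nf
      have e3 : Complex.exp z * Complex.exp (-z) = 1 := by rw [← Complex.exp_add]; simp
      simp only [evolve, Pi.add_apply, e1, e2, ← neg_smul, exp_smul_of_isIdempotentElem hQ]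
      have : (1 - Q + Complex.exp z • Q) * Y * (1 - Q + Complex.exp (-z) • Q) =
          (1 - Q) * Y * (1 - Q) + (Complex.exp z * Complex.exp (-z)) • (Q * Y * Q) +
          Complex.exp z • (Q * Y * (1 - Q)) + Complex.exp (-z) • ((1 - Q) * Y * Q) := by
        simp only [add_mul, mul_add, smul_mul_assoc, mul_smul_comm]
        rw [smul_add, smul_smul, mul_comm (Complex.exp (-z))]
        abel
      rw [mul_smul_comm, smul_mul_assoc, this, e3, one_smul]
      simp only [smul_add, smul_smul]
    rw [key]
    have := abs_le.1 hk
    refine add_mem (add_mem (mem_expSums ?_ _) (mem_expSums ?_ _)) (mem_expSums ?_ _) <;>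
      rw [abs_le] <;> push_cast <;> constructor <;> linarith [this.1, this.2]
  | zero =>
    have : (fun z => evolve Q ((0 : ℂ → 𝔸) z) z) = 0 := by funext z; simp [evolve]
    rw [this]; exact zero_mem _
  | add f g _ _ hf hg =>
    convert add_mem hf hg using 1
    funext z; simp [evolve, mul_add, add_mul]
  | smul c f _ hf =>
    convert Submodule.smul_mem _ c hf using 1
    funext z; simp [evolve]

theorem evolve_add {H K : 𝔸} (h : Commute H K) (X : 𝔸) (z : ℂ) :
    evolve (H + K) X z = evolve H (evolve K X z) z := by
  have hc : Commute (z • H) (z • K) := (h.smul_left z).smul_right z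
  have hc' : Commute (-(z • K)) (-(z • H)) := hc.symm.neg_left.neg_right
  have e : -(z • H + z • K) = -(z • K) + -(z • H) := by abel
  simp only [evolve, smul_add]
  rw [exp_add_of_commute hc, e, exp_add_of_commute hc']
  simp only [mul_assoc]

theorem evolve_of_commute {H X : 𝔸} (h : Commute H X) (z : ℂ) : evolve H X z = X := by
  have : Commute (NormedSpace.exp (z • H)) X := (h.smul_left z).exp_left
  rw [evolve, this.eq, mul_assoc, exp_mul_exp_neg, mul_one]

/-- Evolution under a sum of `D` commuting idempotents is an exponential sum of degree `D`,
whatever the operator `X`. -/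
theorem evolve_sum_idempotent_mem_expSums {ι : Type*} (p : ι → 𝔸)
    (hp : ∀ i, IsIdempotentElem (p i)) (hc : ∀ i j, Commute (p i) (p j)) (X : 𝔸) (s : Finset ι) :
    evolve (∑ i ∈ s, p i) X ∈ expSums 𝔸 s.card := by
  classical
  induction s using Finset.induction_on with
  | empty =>
    have : evolve (∑ i ∈ (∅ : Finset ι), p i) X = fun z : ℂ => Complex.exp ((0 : ℤ) * z) • X := by
      funext z; simp [evolve]
    rw [this]
    exact mem_expSums (by simp) X
  | insert a s ha ih =>
    rw [Finset.sum_insert ha, Finset.card_insert_of_notMem ha]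
    have : evolve (p a + ∑ i ∈ s, p i) X = fun z => evolve (p a) (evolve (∑ i ∈ s, p i) X z) z :=
      funext fun z => evolve_add (Commute.sum_right _ _ _ fun i _ => hc a i) X z
    rw [this]
    exact evolve_idempotent_mem_expSums (hp a) ih

/-- The comparison of `e^{-b(H + V)}` with `e^{-bH}`: Grönwall's inequality for
`F(t) = e^{tH} e^{-t(H + V)}`, which satisfies `F' = -(evolve H V t) F`. -/
theorem norm_exp_mul_exp_neg_add_le {H V : 𝔸} {K b : ℝ} (hb : 0 ≤ b) (h1 : ‖(1 : 𝔸)‖ ≤ 1)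
    (hK : ∀ t : ℝ, 0 ≤ t → t ≤ b → ‖evolve H V t‖ ≤ K) :
    ‖NormedSpace.exp ((b : ℂ) • H) * NormedSpace.exp (-((b : ℂ) • (H + V)))‖ ≤
      Real.exp (K * b) := by
  set F : ℝ → 𝔸 := fun t =>
    NormedSpace.exp ((t : ℂ) • H) * NormedSpace.exp (-((t : ℂ) • (H + V))) with hF
  have hd : ∀ t : ℝ, HasDerivAt F (-(evolve H V t * F t)) t := by
    intro t
    have d1 := (hasDerivAt_exp_smul_const (𝕂 := ℂ) H (t : ℂ)).scomp t
      (Complex.ofRealCLM.hasDerivAt (x := t))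
    have d2 := (hasDerivAt_exp_smul_const' (𝕂 := ℂ) (-(H + V)) (t : ℂ)).scomp t
      (Complex.ofRealCLM.hasDerivAt (x := t))
    have d := d1.mul d2
    simp only [smul_neg, Complex.ofRealCLM_apply, Complex.ofReal_one, one_smul,
      Function.comp_def] at d
    refine d.congr_deriv ?_
    have e : NormedSpace.exp (-((t : ℂ) • H)) * NormedSpace.exp ((t : ℂ) • H) = 1 := by
      simpa using exp_mul_exp_neg (-((t : ℂ) • H))
    simp only [hF, evolve]
    rw [mul_assoc (NormedSpace.exp ((t : ℂ) • H) * V),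
      ← mul_assoc (NormedSpace.exp (-((t : ℂ) • H))), e, one_mul]
    noncomm_ring
  have key := norm_le_gronwallBound_of_norm_deriv_right_le (f := F)
    (f' := fun t => -(evolve H V t * F t)) (δ := 1) (K := K) (ε := 0) (a := 0) (b := b)
    (fun t _ => (hd t).continuousAt.continuousWithinAt) (fun t _ => (hd t).hasDerivWithinAt)
    (by simpa [hF] using h1)
    (fun t ht => by
      rw [norm_neg, add_zero]
      exact (norm_mul_le _ _).trans
        (mul_le_mul_of_nonneg_right (hK t ht.1 ht.2.le) (norm_nonneg _)))
    b ⟨hb, le_rfl⟩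
  rw [gronwallBound_ε0, sub_zero, one_mul] at key
  exact key

end BanachAlgebra

/-! ### Exponentials of self-adjoint operators -/

section CStarAlgebra

variable {A : Type*} [CStarAlgebra A]

theorem exp_I_smul_mem_unitary {H : A} (hH : IsSelfAdjoint H) (θ : ℝ) :
    NormedSpace.exp ((θ * Complex.I : ℂ) • H) ∈ unitary A := by
  let := NormedAlgebra.restrictScalars ℚ ℂ A
  refine NormedSpace.exp_mem_unitary_of_mem_skewAdjoint ?_
  rw [skewAdjoint.mem_iff, star_smul, hH.star_eq, ← neg_smul]
  simp

theorem norm_evolve_I_mul {H : A} (hH : IsSelfAdjoint H) (X : A) (θ : ℝ) :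
    ‖evolve H X (θ * Complex.I)‖ = ‖X‖ := by
  have h := exp_I_smul_mem_unitary hH (-θ)
  rw [Complex.ofReal_neg, neg_mul, neg_smul] at h
  rw [evolve, CStarRing.norm_mul_mem_unitary _ h,
    CStarRing.norm_mem_unitary_mul _ (exp_I_smul_mem_unitary hH θ)]

theorem one_add_le_exp [PartialOrder A] [StarOrderedRing A] {X : A} (hX : IsSelfAdjoint X) :
    1 + X ≤ NormedSpace.exp X := by
  have h : cfc (fun x : ℝ => 1 + x) X = 1 + X := by
    rw [cfc_const_add (1 : ℝ) (fun x : ℝ => x) X, cfc_id' ℝ X, map_one]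
  rw [← h, ← CFC.real_exp_eq_normedSpace_exp hX]
  exact cfc_mono fun x _ => by rw [add_comm]; exact Real.add_one_le_exp x

theorem norm_exp_neg_le_one [PartialOrder A] [StarOrderedRing A] {X : A} (hX : 0 ≤ X) :
    ‖NormedSpace.exp (-X)‖ ≤ 1 := by
  have hs : IsSelfAdjoint X := .of_nonneg hX
  have h : cfc (fun x : ℝ => Real.exp (-x)) X = NormedSpace.exp (-X) := by
    rw [cfc_comp_neg Real.exp X, CFC.real_exp_eq_normedSpace_exp hs.neg]
  rw [← h]
  refine norm_cfc_le zero_le_one fun x hx => ?_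
  rw [Real.norm_eq_abs, Real.abs_exp, Real.exp_le_one_iff, neg_nonpos]
  exact spectrum_nonneg_of_nonneg hX hx

end CStarAlgebra

section HilbertSpace

variable {E : Type*} [NormedAddCommGroup E] [InnerProductSpace ℂ E] [CompleteSpace E]

/-- Jensen's inequality `e^{⟨ψ, Hψ⟩} ≤ ⟨ψ, e^H ψ⟩`: apply `1 + Y ≤ e^Y` to `Y = H - ⟨ψ, Hψ⟩`, whose
expectation in `ψ` vanishes. -/
theorem exp_re_inner_le {H : E →L[ℂ] E} (hH : IsSelfAdjoint H) {ψ : E} (hψ : ‖ψ‖ = 1) :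
    Real.exp (RCLike.re ⟪ψ, H ψ⟫_ℂ) ≤ RCLike.re ⟪ψ, NormedSpace.exp H ψ⟫_ℂ := by
  set c : ℝ := RCLike.re ⟪ψ, H ψ⟫_ℂ with hc
  have hψ2 : ⟪ψ, ψ⟫_ℂ = 1 := by rw [inner_self_eq_norm_sq_to_K, hψ]; simp
  have hY : IsSelfAdjoint (H - (c : ℂ) • (1 : E →L[ℂ] E)) :=
    hH.sub (IsSelfAdjoint.smul (by simp [isSelfAdjoint_iff]) (.one _))
  have hexp : NormedSpace.exp H =
      Complex.exp c • NormedSpace.exp (H - (c : ℂ) • (1 : E →L[ℂ] E)) := by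
    rw [← exp_add_smul_one, sub_add_cancel]
  have hle := ((ContinuousLinearMap.le_def _ _).1 (one_add_le_exp hY)).re_inner_nonneg_right ψ
  have h1 : RCLike.re ⟪ψ, (1 + (H - (c : ℂ) • (1 : E →L[ℂ] E))) ψ⟫_ℂ = 1 := by
    simp only [add_apply, sub_apply,
      smul_apply, one_apply_eq_self, inner_add_right,
      inner_sub_right, inner_smul_right, hψ2, map_add, map_sub, ← hc]
    simp
  rw [sub_apply, inner_sub_right, map_sub, h1, sub_nonneg] at hle
  rw [hexp, smul_apply, inner_smul_right, ← Complex.ofReal_exp]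
  have : RCLike.re ((Real.exp c : ℂ) *
      ⟪ψ, NormedSpace.exp (H - (c : ℂ) • (1 : E →L[ℂ] E)) ψ⟫_ℂ) = Real.exp c *
      RCLike.re ⟪ψ, NormedSpace.exp (H - (c : ℂ) • (1 : E →L[ℂ] E)) ψ⟫_ℂ :=
    Complex.re_ofReal_mul _ _
  rw [this]
  exact le_mul_of_one_le_right (Real.exp_pos c).le hle

/-- If `H` commutes with the projector onto `K` and has energy at least `e` on `K`, then `e^{-bH}`
has norm at most `e^{-be}` on `K`. -/
theorem norm_exp_neg_mul_starProjection_le {H : E →L[ℂ] E} (hH : IsSelfAdjoint H)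
    (K : Submodule ℂ E) [K.HasOrthogonalProjection] (hK : Commute H K.starProjection) {e b : ℝ}
    (hb : 0 ≤ b) (he : ∀ φ ∈ K, ‖φ‖ = 1 → e ≤ RCLike.re ⟪φ, H φ⟫_ℂ) :
    ‖NormedSpace.exp (-((b : ℂ) • H)) * K.starProjection‖ ≤ Real.exp (-(b * e)) := by
  set Q := K.starProjection with hQ
  have hQs : IsSelfAdjoint Q := isSelfAdjoint_starProjection K
  have hQi : IsIdempotentElem Q := K.isIdempotentElem_starProjection
  have he' : ∀ φ ∈ K, e * ‖φ‖ ^ 2 ≤ RCLike.re ⟪φ, H φ⟫_ℂ := by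
    intro φ hφ
    rcases eq_or_ne φ 0 with rfl | h0
    · simp
    have hn : ‖φ‖ ≠ 0 := norm_ne_zero_iff.2 h0
    have h := he (((‖φ‖⁻¹ : ℝ) : ℂ) • φ) (K.smul_mem _ hφ) (by
      rw [norm_smul, Complex.norm_real, norm_inv, norm_norm, inv_mul_cancel₀ hn])
    rw [map_smul, inner_smul_left, inner_smul_right, ← mul_assoc, Complex.conj_ofReal,
      ← Complex.ofReal_mul] at h
    have h2 : e ≤ (‖φ‖⁻¹ * ‖φ‖⁻¹) * RCLike.re ⟪φ, H φ⟫_ℂ := h.trans_eq (Complex.re_ofReal_mul _ _)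
    have hpos : 0 < ‖φ‖ ^ 2 := by positivity
    calc e * ‖φ‖ ^ 2 ≤ ((‖φ‖⁻¹ * ‖φ‖⁻¹) * RCLike.re ⟪φ, H φ⟫_ℂ) * ‖φ‖ ^ 2 := by gcongr
      _ = RCLike.re ⟪φ, H φ⟫_ℂ := by field_simp
  set Y : E →L[ℂ] E := (b : ℂ) • (H - (e : ℂ) • (1 : E →L[ℂ] E)) with hYdef
  have hYs : IsSelfAdjoint Y :=
    IsSelfAdjoint.smul (by simp [isSelfAdjoint_iff])
      (hH.sub (IsSelfAdjoint.smul (by simp [isSelfAdjoint_iff]) (.one _)))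
  have hYQ : Commute Y Q := (hK.sub_left ((Commute.one_left Q).smul_left _)).smul_left _
  have hpos : 0 ≤ Y * Q := by
    rw [ContinuousLinearMap.nonneg_iff_isPositive, ContinuousLinearMap.isPositive_def']
    refine ⟨(hYs.commute_iff hQs).1 hYQ, fun x => ?_⟩
    have e1 : Y * Q = Q * (Y * Q) := by rw [← mul_assoc, ← hYQ.eq, mul_assoc, hQi.eq]
    have hmem : Q x ∈ K := K.starProjection_apply_mem x
    rw [ContinuousLinearMap.reApplyInnerSelf_apply, e1, mul_apply_eq_comp,
      mul_apply_eq_comp, hQ, Submodule.inner_starProjection_left_eq_right, ← hQ,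
      ← inner_conj_symm, RCLike.conj_re]
    have hv := he' _ hmem
    generalize Q x = φ at hv
    have : RCLike.re ⟪φ, Y φ⟫_ℂ = b * (RCLike.re ⟪φ, H φ⟫_ℂ - e * ‖φ‖ ^ 2) := by
      rw [hYdef, smul_apply, inner_smul_right]
      refine (Complex.re_ofReal_mul _ _).trans ?_
      rw [sub_apply, inner_sub_right, smul_apply,
        inner_smul_right, one_apply_eq_self, inner_self_eq_norm_sq_to_K, Complex.sub_re]
      congr 2
      rw [Complex.re_ofReal_mul]
      congr 1
      norm_cast
    rw [this]
    exact mul_nonneg hb (sub_nonneg.2 hv)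
  have hsplit : -((b : ℂ) • H) = -Y + ((-(b * e) : ℝ) : ℂ) • (1 : E →L[ℂ] E) := by
    rw [hYdef, smul_sub, smul_smul]; push_cast; rw [neg_smul]; abel
  rw [hsplit, exp_add_smul_one, smul_mul_assoc, norm_smul, ← Complex.ofReal_exp, Complex.norm_real,
    Real.norm_eq_abs, Real.abs_exp,
    exp_mul_of_commute_idempotent hQi hYQ.neg_left, neg_mul]
  refine mul_le_of_le_one_right (Real.exp_pos _).le ?_
  calc _ ≤ ‖NormedSpace.exp (-(Y * Q))‖ * ‖Q‖ := norm_mul_le _ _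
    _ ≤ 1 * 1 := mul_le_mul (norm_exp_neg_le_one hpos) K.starProjection_norm_le (norm_nonneg _)
        zero_le_one
    _ = 1 := one_mul 1

end HilbertSpace

/-! ### The trace and the trace norm -/

section Trace

variable {n : ℕ}

theorem tr_smul (c : ℂ) (A : Op n) : tr (c • A) = c * tr A := by
  simp [tr]

theorem tr_mul_comm (A B : Op n) : tr (A * B) = tr (B * A) :=
  LinearMap.trace_mul_comm ℂ A.toLinearMap B.toLinearMap

theorem tr_eq_sum_inner {ι : Type*} [Fintype ι] (b : OrthonormalBasis ι ℂ (Qubits n)) (A : Op n) :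
    tr A = ∑ i, ⟪b i, A (b i)⟫_ℂ :=
  LinearMap.trace_eq_sum_inner A.toLinearMap b

theorem traceNorm_le (A : Op n) : traceNorm A ≤ 2 ^ n * ‖A‖ := by
  rw [traceNorm, tr_eq_sum_inner (EuclideanSpace.basisFun (Fin n → Fin 2) ℂ), Complex.re_sum]
  have hcard : (2 : ℝ) ^ n = (Finset.univ : Finset (Fin n → Fin 2)).card := by simp
  rw [hcard, ← nsmul_eq_mul, ← Finset.sum_const]
  refine Finset.sum_le_sum fun i _ => ?_
  set v := EuclideanSpace.basisFun (Fin n → Fin 2) ℂ i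
  have hv : ‖v‖ = 1 := (EuclideanSpace.basisFun (Fin n → Fin 2) ℂ).orthonormal.1 i
  calc (⟪v, CFC.abs A v⟫_ℂ).re ≤ ‖v‖ * ‖CFC.abs A v‖ := re_inner_le_norm (𝕜 := ℂ) _ _
    _ ≤ 1 * (‖CFC.abs A‖ * 1) := by
        rw [hv]; gcongr
        simpa [hv] using (CFC.abs A).le_opNorm v
    _ = ‖A‖ := by rw [CFC.norm_abs]; ring

/-- The trace of `P A P` in an orthonormal basis that contains `ψ` has non-negative terms, one of
which is `⟨ψ, A ψ⟩`. -/
theorem re_inner_le_re_tr_proj_mul {A : Op n} (hA : 0 ≤ A) {𝒱 : Submodule ℂ (Qubits n)}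
    {ψ : Qubits n} (hψ : ψ ∈ 𝒱) (hψ1 : ‖ψ‖ = 1) :
    RCLike.re ⟪ψ, A ψ⟫_ℂ ≤ (tr (proj 𝒱 * A)).re := by
  have hon : Orthonormal ℂ ((↑) : ({ψ} : Set (Qubits n)) → Qubits n) := by
    refine ⟨fun i => ?_, fun i j hij => (hij (Subsingleton.elim i j)).elim⟩
    rw [Set.mem_singleton_iff.1 i.2, hψ1]
  obtain ⟨u, b, hu, hb⟩ := hon.exists_orthonormalBasis_extension
  have hPP : proj 𝒱 * proj 𝒱 = proj 𝒱 := 𝒱.isIdempotentElem_starProjection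
  rw [← hPP, mul_assoc, tr_mul_comm, tr_eq_sum_inner b, Complex.re_sum]
  have hterm : ∀ i, (⟪b i, (proj 𝒱 * A * proj 𝒱) (b i)⟫_ℂ).re =
      RCLike.re ⟪proj 𝒱 (b i), A (proj 𝒱 (b i))⟫_ℂ := by
    intro i
    rw [mul_apply_eq_comp, mul_apply_eq_comp]
    simp only [proj]
    rw [← Submodule.inner_starProjection_left_eq_right]
    rfl
  have hpos : ∀ i, 0 ≤ (⟪b i, (proj 𝒱 * A * proj 𝒱) (b i)⟫_ℂ).re := fun i => by
    rw [hterm]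
    exact ((ContinuousLinearMap.nonneg_iff_isPositive A).1 hA).re_inner_nonneg_right _
  have hbψ : b ⟨ψ, hu rfl⟩ = ψ := by rw [hb]
  have hPψ : proj 𝒱 ψ = ψ := Submodule.starProjection_eq_self_iff.2 hψ
  have h := Finset.single_le_sum (fun i _ => hpos i) (Finset.mem_univ (⟨ψ, hu rfl⟩ : u))
  rwa [hterm, hbψ, hPψ] at h

theorem tr_exp_pos {H : Op n} (hH : IsSelfAdjoint H) :
    tr (NormedSpace.exp H) = ((tr (NormedSpace.exp H)).re : ℂ) ∧
      0 < (tr (NormedSpace.exp H)).re := by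
  set b := EuclideanSpace.basisFun (Fin n → Fin 2) ℂ
  have hA : 0 ≤ NormedSpace.exp H := hH.exp_nonneg
  constructor
  · rw [tr_eq_sum_inner b, Complex.re_sum, Complex.ofReal_sum]
    refine Finset.sum_congr rfl fun i _ => ?_
    have hp := (ContinuousLinearMap.nonneg_iff_isPositive _).1 hA
    exact (Complex.conj_eq_iff_re.1 (by
      rw [inner_conj_symm]; exact hp.isSymmetric (b i) (b i))).symm
  · have h1 : ‖b 0‖ = 1 := b.orthonormal.1 0
    have h := re_inner_le_re_tr_proj_mul hA (Submodule.mem_top (x := b 0)) h1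
    have hp : proj (⊤ : Submodule ℂ (Qubits n)) = 1 := Submodule.starProjection_top'
    rw [hp, one_mul] at h
    exact (Real.exp_pos _).trans_le ((exp_re_inner_le hH h1).trans h)

end Trace

/-! ### Locality -/

section Locality

variable {n : ℕ}

/-- The matrix of `B ⊗ 1`, with `B` acting on the qubits in `T`. -/
def extendMatrix (T : Finset (Fin n)) (B : Matrix (T → Fin 2) (T → Fin 2) ℂ) :
    Matrix (Fin n → Fin 2) (Fin n → Fin 2) ℂ :=
  Matrix.of fun x y => if ∀ i, i ∉ T → x i = y i then B (fun i => x i) (fun i => y i) else 0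

/-- In the sum over the intermediate bit string only one string survives: it agrees with `y` on `S`
and with `x` elsewhere. The outcome is symmetric in the two factors. -/
theorem extendMatrix_mul_apply {S T : Finset (Fin n)} (h : Disjoint S T)
    (A : Matrix (S → Fin 2) (S → Fin 2) ℂ) (B : Matrix (T → Fin 2) (T → Fin 2) ℂ)
    (x y : Fin n → Fin 2) :
    (extendMatrix S A * extendMatrix T B) x y =
      if ∀ i, i ∉ S → i ∉ T → x i = y i then
        A (fun i => x i) (fun i => y i) * B (fun i => x i) (fun i => y i) else 0 := by
  classical
  rw [Matrix.mul_apply, Finset.sum_eq_single_of_mem (fun i => if i ∈ S then y i else x i)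
    (Finset.mem_univ _)]
  · have hS : (fun i : S => if (i : Fin n) ∈ S then y i else x i) = fun i : S => y i := by
      funext i; simp
    have hT : (fun i : T => if (i : Fin n) ∈ S then y i else x i) = fun i : T => x i := by
      funext i; simp [Finset.disjoint_right.1 h i.2]
    have h1 : ∀ i, i ∉ S → x i = if i ∈ S then y i else x i := fun i hi => by simp [hi]
    have h2 : (∀ i, i ∉ T → (if i ∈ S then y i else x i) = y i) ↔
        ∀ i, i ∉ S → i ∉ T → x i = y i := by
      refine forall_congr' fun i => ?_
      by_cases hi : i ∈ S <;> simp [hi]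
    simp only [extendMatrix, Matrix.of_apply, hS, hT, if_pos h1, h2, mul_ite, mul_zero]
  · intro z _ hz
    by_contra hne
    obtain ⟨hA, hB⟩ := mul_ne_zero_iff.1 hne
    simp only [extendMatrix, Matrix.of_apply, ne_eq, ite_eq_right_iff, not_forall] at hA hB
    refine hz (funext fun i => ?_)
    by_cases hi : i ∈ S
    · simpa [hi] using hB.1 i (Finset.disjoint_left.1 h hi)
    · simpa [hi] using (hA.1 i hi).symm

theorem ActsOn.commute {S T : Finset (Fin n)} {A B : Op n} (hA : ActsOn S A) (hB : ActsOn T B)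
    (h : Disjoint S T) : Commute A B := by
  obtain ⟨A, rfl⟩ := hA
  obtain ⟨B, rfl⟩ := hB
  change opOfMatrix (extendMatrix S A) * opOfMatrix (extendMatrix T B) =
    opOfMatrix (extendMatrix T B) * opOfMatrix (extendMatrix S A)
  simp only [opOfMatrix, ← map_mul]
  congr 1
  ext x y
  rw [extendMatrix_mul_apply h, extendMatrix_mul_apply h.symm]
  simp only [mul_comm]
  congr 1
  exact propext ⟨fun h i a b => h i b a, fun h i a b => h i b a⟩

variable {k w₀ : ℕ}

theorem CommutingProjectors.ham_nonneg (P : CommutingProjectors n k w₀) : 0 ≤ P.ham :=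
  Finset.sum_nonneg fun j _ => (P.isProjector j).nonneg

theorem CommutingProjectors.ham_isSelfAdjoint (P : CommutingProjectors n k w₀) :
    IsSelfAdjoint P.ham :=
  .of_nonneg P.ham_nonneg

theorem CommutingProjectors.card_meets_le (P : CommutingProjectors n k w₀) (T : Finset (Fin n)) :
    (Finset.univ.filter fun j => ¬ Disjoint (P.supp j) T).card ≤ T.card * w₀ := by
  classical
  have hsub : (Finset.univ.filter fun j => ¬ Disjoint (P.supp j) T) ⊆
      T.biUnion fun q => Finset.univ.filter fun j => q ∈ P.supp j := by
    intro j hj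
    obtain ⟨q, hq, hqT⟩ := Finset.not_disjoint_iff.1 (Finset.mem_filter.1 hj).2
    exact Finset.mem_biUnion.2 ⟨q, hqT, by simpa using hq⟩
  exact (Finset.card_le_card hsub).trans
    (Finset.card_biUnion_le_card_mul _ _ _ fun q _ => P.degree_le q)

/-- The projectors whose support is disjoint from `T` commute with `X` and drop out of its
evolution; at most `w₀` of the others contain a given qubit of `T`. -/
theorem CommutingProjectors.evolve_mem_expSums_of_actsOn (P : CommutingProjectors n k w₀)
    {T : Finset (Fin n)} {X : Op n} (hX : ActsOn T X) :
    evolve P.ham X ∈ expSums (Op n) (T.card * w₀) := by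
  classical
  have hsplit := Finset.sum_filter_add_sum_filter_not Finset.univ
    (fun j => ¬ Disjoint (P.supp j) T) P.term
  have hfar : Commute (∑ j ∈ Finset.univ.filter fun j => ¬ ¬ Disjoint (P.supp j) T, P.term j) X :=
    Commute.sum_left _ _ _ fun j hj =>
      (P.actsOn j).commute hX (not_not.1 (Finset.mem_filter.1 hj).2)
  have hev : evolve P.ham X =
      evolve (∑ j ∈ Finset.univ.filter fun j => ¬ Disjoint (P.supp j) T, P.term j) X := by
    funext z
    rw [CommutingProjectors.ham, ← hsplit, evolve_add, evolve_of_commute hfar]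
    exact Commute.sum_left _ _ _ fun i _ => Commute.sum_right _ _ _ fun j _ => P.commute i j
  rw [hev]
  exact expSums_mono (P.card_meets_le T)
    (evolve_sum_idempotent_mem_expSums P.term (fun j => (P.isProjector j).isIdempotentElem)
      P.commute X _)

theorem CommutingProjectors.evolve_mem_expSums (P : CommutingProjectors n k w₀) {w₁ : ℕ} {V : Op n}
    (hV : IsLocalPerturbation w₁ V) : evolve P.ham V ∈ expSums (Op n) (w₁ * w₀) := by
  obtain ⟨-, m, t, ht, rfl⟩ := hV
  have : evolve P.ham (∑ l, t l) = ∑ l, evolve P.ham (t l) := by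
    funext z
    simp only [evolve, Finset.sum_apply, Finset.mul_sum, Finset.sum_mul]
  rw [this]
  refine sum_mem fun l _ => ?_
  obtain ⟨T, hT, hact⟩ := ht l
  exact expSums_mono (Nat.mul_le_mul_right _ hT) (P.evolve_mem_expSums_of_actsOn hact)

/-- The bound involves the norm of `V` only; neither the number of its terms nor their norms
enter. -/
theorem CommutingProjectors.norm_evolve_le (P : CommutingProjectors n k w₀) {w₁ : ℕ} {V : Op n}
    (hV : IsLocalPerturbation w₁ V) {t : ℝ} (ht : 0 ≤ t) :
    ‖evolve P.ham V t‖ ≤ (2 * (w₁ * w₀ : ℕ) + 1) * Real.exp (t * (w₁ * w₀ : ℕ)) * ‖V‖ :=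
  norm_le_of_mem_expSums (P.evolve_mem_expSums hV)
    (fun θ => (norm_evolve_I_mul P.ham_isSelfAdjoint V θ).le) ht

end Locality

/-! ### The bottleneck ratio of the Gibbs state -/

/-- The bottleneck ratio is controlled by the energy difference between a trial vector `ψ` of `𝒱`
and the boundary, up to the norm of `V` and a bound `K` on its imaginary-time evolution. -/
theorem bottleneckRatio_gibbs_le {n : ℕ} {H V : Op n} (hH : IsSelfAdjoint H) (hV : IsSelfAdjoint V)
    {𝒱 : Submodule ℂ (Qubits n)} {r : ℕ} {β e K : ℝ} (hβ : 0 ≤ β)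
    (hc : Commute H (proj (boundary r 𝒱)))
    (he : ∀ φ ∈ boundary r 𝒱, ‖φ‖ = 1 → e ≤ RCLike.re ⟪φ, H φ⟫_ℂ)
    (hK : ∀ t : ℝ, 0 ≤ t → t ≤ β → ‖evolve H V t‖ ≤ K)
    {ψ : Qubits n} (hψ : ψ ∈ 𝒱) (hψ1 : ‖ψ‖ = 1) :
    bottleneckRatio (gibbs β (H + V)) r 𝒱 ≤
      2 ^ n * Real.exp (β * (RCLike.re ⟪ψ, H ψ⟫_ℂ + ‖V‖ + K - e)) := by
  set B : Op n := proj (boundary r 𝒱) with hB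
  have hβs : IsSelfAdjoint (β : ℂ) := by simp [isSelfAdjoint_iff]
  have hHV : IsSelfAdjoint (H + V) := IsSelfAdjoint.add (R := Op n) hH hV
  have hβHV : IsSelfAdjoint ((β : ℂ) • (H + V)) :=
    IsSelfAdjoint.smul (A := Op n) hβs hHV
  have hs : IsSelfAdjoint (-((β : ℂ) • (H + V))) :=
    IsSelfAdjoint.neg (R := Op n) hβHV
  obtain ⟨hZ, hZpos⟩ := tr_exp_pos hs
  set G : Op n := NormedSpace.exp (-((β : ℂ) • (H + V))) with hG
  set z : ℝ := (tr G).re with hz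
  have hneg : (-β : ℂ) • (H + V) = -((β : ℂ) • (H + V)) := neg_smul (β : ℂ) (H + V)
  have hgibbs : gibbs β (H + V) = ((z⁻¹ : ℝ) : ℂ) • G := by
    rw [gibbs, hneg, ← hG, hZ, Complex.ofReal_inv]
  -- Jensen's inequality bounds the unnormalised overlap with `𝒱` from below
  have hden : Real.exp (-(β * (RCLike.re ⟪ψ, H ψ⟫_ℂ + ‖V‖))) ≤ (tr (proj 𝒱 * G)).re := by
    refine le_trans ?_ ((exp_re_inner_le hs hψ1).trans
      (re_inner_le_re_tr_proj_mul hs.exp_nonneg hψ hψ1))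
    rw [Real.exp_le_exp, ← hneg, smul_apply, inner_smul_right, add_apply, inner_add_right,
      ← Complex.ofReal_neg]
    refine le_of_le_of_eq ?_ (Complex.re_ofReal_mul _ _).symm
    rw [Complex.add_re, neg_mul, neg_le_neg_iff]
    refine mul_le_mul_of_nonneg_left (add_le_add_right ?_ _) hβ
    calc (⟪ψ, V ψ⟫_ℂ).re ≤ ‖ψ‖ * ‖V ψ‖ := re_inner_le_norm (𝕜 := ℂ) _ _
      _ ≤ 1 * (‖V‖ * ‖ψ‖) := by rw [hψ1]; gcongr; simpa [hψ1] using V.le_opNorm ψ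
      _ = ‖V‖ := by rw [hψ1]; ring
  -- `B e^{-β(H + V)} = e^{-βH} B · e^{βH} e^{-β(H + V)}`, as `B` commutes with `H`
  have hnum : ‖B * G‖ ≤ Real.exp (-(β * e)) * Real.exp (K * β) := by
    have hsplit : B * G = (NormedSpace.exp (-((β : ℂ) • H)) * B) *
        (NormedSpace.exp ((β : ℂ) • H) * G) := by
      have h1 : Commute (NormedSpace.exp (-((β : ℂ) • H))) B :=
        ((hc.smul_left (β : ℂ)).neg_left).exp_left
      have h2 : NormedSpace.exp (-((β : ℂ) • H)) * NormedSpace.exp ((β : ℂ) • H) = 1 := by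
        simpa using exp_mul_exp_neg (-((β : ℂ) • H))
      rw [h1.eq, mul_assoc, ← mul_assoc (NormedSpace.exp (-((β : ℂ) • H))), h2, one_mul]
    rw [hsplit]
    exact (norm_mul_le _ _).trans (mul_le_mul (norm_exp_neg_mul_starProjection_le hH _ hc hβ he)
      (norm_exp_mul_exp_neg_add_le hβ ContinuousLinearMap.norm_id_le hK) (norm_nonneg _)
      (Real.exp_pos _).le)
  have hzinv : 0 < z⁻¹ := inv_pos.2 hZpos
  rw [bottleneckRatio, hgibbs, mul_smul_comm, mul_smul_comm, tr_smul, Complex.re_ofReal_mul]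
  rw [div_le_iff₀ (mul_pos hzinv ((Real.exp_pos _).trans_le hden))]
  calc traceNorm (((z⁻¹ : ℝ) : ℂ) • (B * G)) ≤ 2 ^ n * (z⁻¹ * ‖B * G‖) := by
        refine (traceNorm_le _).trans_eq ?_
        rw [norm_smul, Complex.norm_real, Real.norm_of_nonneg hzinv.le]
    _ ≤ 2 ^ n * (z⁻¹ * (Real.exp (-(β * e)) * Real.exp (K * β))) := by gcongr
    _ = 2 ^ n * Real.exp (β * (RCLike.re ⟪ψ, H ψ⟫_ℂ + ‖V‖ + K - e)) *
        (z⁻¹ * Real.exp (-(β * (RCLike.re ⟪ψ, H ψ⟫_ℂ + ‖V‖)))) := by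
        have : Real.exp (-(β * e)) * Real.exp (K * β) =
            Real.exp (β * (RCLike.re ⟪ψ, H ψ⟫_ℂ + ‖V‖ + K - e)) *
              Real.exp (-(β * (RCLike.re ⟪ψ, H ψ⟫_ℂ + ‖V‖))) := by
          rw [← Real.exp_add, ← Real.exp_add]; congr 1; ring
        rw [this]; ring
    _ ≤ _ := by gcongr

theorem minEnergy_le {n : ℕ} (H : Op n) {𝒱 : Submodule ℂ (Qubits n)} {φ : Qubits n} (hφ : φ ∈ 𝒱)
    (h1 : ‖φ‖ = 1) : minEnergy H 𝒱 ≤ ((RCLike.re ⟪φ, H φ⟫_ℂ : ℝ) : EReal) :=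
  iInf₂_le_of_le φ hφ (iInf_le _ h1)

theorem minEnergy_nonneg {n : ℕ} {H : Op n} (hH : 0 ≤ H) (𝒱 : Submodule ℂ (Qubits n)) :
    0 ≤ minEnergy H 𝒱 :=
  le_iInf₂ fun φ _ => le_iInf fun _ => EReal.coe_nonneg.2
    (((ContinuousLinearMap.nonneg_iff_isPositive H).1 hH).re_inner_nonneg_right φ)

theorem exists_re_inner_lt_of_minEnergy_lt {n : ℕ} {H : Op n} {𝒱 : Submodule ℂ (Qubits n)} {a : ℝ}
    (h : minEnergy H 𝒱 < (a : EReal)) :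
    ∃ ψ ∈ 𝒱, ‖ψ‖ = 1 ∧ RCLike.re ⟪ψ, H ψ⟫_ℂ < a := by
  simp only [minEnergy, iInf_lt_iff] at h
  obtain ⟨ψ, hψ, h1, h⟩ := h
  exact ⟨ψ, hψ, h1, EReal.coe_lt_coe_iff.1 h⟩

end QBottleneck

theorem theorem5 (k w₀ w₁ : ℕ) (κ ε : ℝ) (hκ : 0 < κ) (hε₀ : 0 ≤ ε) (hε : ε < κ / 2) :
    ∃ βstar : ℝ, 0 < βstar ∧ βstar ≤ Real.log 2 / (κ - 2 * ε) ∧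
      (0 < ε → βstar < Real.log 2 / (κ - 2 * ε)) ∧
      ∀ β : ℝ, βstar < β → ∃ gstar : ℝ, 0 < gstar ∧
        ∀ g : ℝ, g < gstar → ∃ c : ℝ, 0 < c ∧ ∃ n₀ : ℕ, ∀ n : ℕ, n₀ ≤ n →
          ∀ (P : QBottleneck.CommutingProjectors n k w₀) (V : QBottleneck.Op n)
            (𝒱 : Submodule ℂ (QBottleneck.Qubits n)) (r : ℕ),
            QBottleneck.IsLocalPerturbation w₁ V →
            ‖V‖ ≤ g * n →
            QBottleneck.minEnergy P.ham 𝒱 ≤ ((ε * n : ℝ) : EReal) →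
            QBottleneck.minEnergy P.ham 𝒱 + ((κ * n : ℝ) : EReal) ≤
              QBottleneck.minEnergy P.ham (QBottleneck.boundary r 𝒱) →
            Commute P.ham (QBottleneck.proj (QBottleneck.boundary r 𝒱)) →
            QBottleneck.bottleneckRatio (QBottleneck.gibbs β (P.ham + V)) r 𝒱 ≤
              Real.exp (-(c * n)) := by
  have hlog : 0 < Real.log 2 := Real.log_pos one_lt_two
  have hgap : 0 < κ - 2 * ε := by linarith
  refine ⟨Real.log 2 / κ, div_pos hlog hκ, ?_, fun h => ?_, fun β hβ => ?_⟩
  · exact div_le_div_of_nonneg_left hlog.le hgap (by linarith)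
  · exact div_lt_div_of_pos_left hlog hgap (by linarith)
  have hβ0 : 0 < β := (div_pos hlog hκ).trans hβ
  set a : ℝ := β * κ - Real.log 2 with ha
  have ha0 : 0 < a := by rw [div_lt_iff₀ hκ] at hβ; linarith
  set C : ℝ := (2 * (w₁ * w₀ : ℕ) + 1) * Real.exp (β * (w₁ * w₀ : ℕ)) with hC
  have hC0 : 0 < C := by positivity
  -- half of the surplus `a` pays for `V`, a quarter for the choice of a nearly optimal vector
  refine ⟨a / (2 * β * (1 + C)), by positivity, fun g hg => ⟨a / 4, by positivity, 1, ?_⟩⟩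
  intro n hn P V 𝒱 r hV hVg hE hbarrier hcomm
  have hn0 : (0 : ℝ) < n := by exact_mod_cast hn
  obtain ⟨E, hEdef⟩ : ∃ E : ℝ, QBottleneck.minEnergy P.ham 𝒱 = (E : EReal) := by
    refine ⟨_, (EReal.coe_toReal (ne_top_of_le_ne_top (EReal.coe_ne_top _) hE) ?_).symm⟩
    exact (EReal.bot_lt_zero.trans_le (QBottleneck.minEnergy_nonneg P.ham_nonneg 𝒱)).ne'
  rw [hEdef] at hbarrier
  have hlt : QBottleneck.minEnergy P.ham 𝒱 < ((E + a * n / (4 * β) : ℝ) : EReal) := by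
    rw [hEdef, EReal.coe_lt_coe_iff]
    exact lt_add_of_pos_right _ (by positivity)
  obtain ⟨ψ, hψ, hψ1, hψE⟩ := QBottleneck.exists_re_inner_lt_of_minEnergy_lt hlt
  have hbd : ∀ φ ∈ QBottleneck.boundary r 𝒱, ‖φ‖ = 1 →
      E + κ * n ≤ RCLike.re ⟪φ, P.ham φ⟫_ℂ := fun φ hφ h1 => by
    have := hbarrier.trans (QBottleneck.minEnergy_le P.ham hφ h1)
    exact_mod_cast this
  have hK : ∀ t : ℝ, 0 ≤ t → t ≤ β → ‖QBottleneck.evolve P.ham V t‖ ≤ C * ‖V‖ := fun t h0 ht =>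
    (P.norm_evolve_le hV h0).trans (by rw [hC]; gcongr)
  refine (QBottleneck.bottleneckRatio_gibbs_le P.ham_isSelfAdjoint hV.1 hβ0.le hcomm hbd hK
    hψ hψ1).trans ?_
  have h2 : (2 : ℝ) ^ n = Real.exp (n * Real.log 2) := by
    rw [Real.exp_nat_mul, Real.exp_log two_pos]
  rw [h2, ← Real.exp_add, Real.exp_le_exp]
  have hVbound : β * ((1 + C) * ‖V‖) ≤ a / 2 * n := by
    calc β * ((1 + C) * ‖V‖) ≤ β * ((1 + C) * (a / (2 * β * (1 + C)) * n)) := by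
          gcongr
          exact hVg.trans (by gcongr)
      _ = a / 2 * n := by field_simp
  have hψbound : β * (RCLike.re ⟪ψ, P.ham ψ⟫_ℂ - E) ≤ a / 4 * n := by
    calc β * (RCLike.re ⟪ψ, P.ham ψ⟫_ℂ - E) ≤ β * (a * n / (4 * β)) := by
          gcongr
          linarith
      _ = a / 4 * n := by field_simp
  have : (n : ℝ) * Real.log 2 = β * κ * n - a * n := by rw [ha]; ring
  rw [this]
  linarith
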